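/- Let $D$ be a discrete valuation ring with quotient field $K$, and let $A$ be a finite-dimensional central division algebra over $K$ such that the completion $\widehat A\cong A\otimes_K\widehat K$ is also a division ring. Let $R$ be a $D$-order in $A$ (a subring $R\supseteq D$ of $A$ that is finitely generated as a $D$-module and satisfies $KR=A$), and let $R^\bullet$ be the monoid of cancellative elements of $R$. Notation, for a cancellative monoid $H$ in which every non-unit is a product of finitely many atoms ($H$ is atomic): an atom is a non-unit that is not a product of two non-units; $\mathsf Z^*(H)$ is the monoid of rigid factorizations, that is, of pairs $(\varepsilon,u_1\cdots u_k)$ of a unit $\varepsilon$ and a word of atoms $u_i$, with the product $(\varepsilon,u_1\cdots u_k)*(\varepsilon',v_1\cdots v_l)=(\varepsilon,u_1\cdots (u_k\varepsilon')v_1\cdots v_l)$ (and $(\varepsilon\varepsilon',v_1\cdots v_l)$ if $k=0$), where $(\varepsilon,u_1\cdots u_k)$ and $(\varepsilon',v_1\cdots v_k)$ are identified if there are units $\delta_1=\varepsilon'^{-1}\varepsilon,\delta_2,\dots,\delta_{k+1}=1$ with $v_i=\delta_iu_i\delta_{i+1}^{-1}$ for all $i$; such a factorization $z$ has length $|z|=k$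 and product $\pi(z)=\varepsilon u_1\cdots u_k\in H$. Further, $\mathsf L(a)=\{|z|:\pi(z)=a\}$; $\Delta(H)$ is the set of all $l-k>0$ such that $k,l\in\mathsf L(a)$ and $\mathsf L(a)\cap[k,l]=\{k,l\}$ for some $a\in H$; $\mathcal U_k(H)=\bigcup_{k\in\mathsf L(a)}\mathsf L(a)$; $\rho_k(H)=\sup\mathcal U_k(H)$; and $\rho(H)=\sup_{a\in H}\rho(a)$ with $\rho(a)=\sup\mathsf L(a)/\min\mathsf L(a)$ for non-units $a$ and $\rho(a)=1$ for units. A distance on $H$ is a map $\mathsf d$ to $\mathbb N_0$ from the pairs $(z,z')$ in $\mathsf Z^*(H)$ with $\pi(z)=\pi(z')$ such that $\mathsf d(z,z)=0$, $\mathsf d(z,z')=\mathsf d(z',z)\le \mathsf d(z,z'')+\mathsf d(z'',z')$, $\mathsf d(x*z,x*z')=\mathsf d(z,z')=\mathsf d(z*x,z'*x)$ and $\big||z|-|z'|\big|\le\mathsf d(z,z')\le\max\{|z|,|z'|,1\}$; the catenary degree $\mathsf c_{\mathsf d}(H)\in\mathbb N_0\cup\{\infty\}$ is the least $N$ such that any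 two $z,z'$ with the same product $a$ can be joined by a finite sequence $z=z_0,\dots,z_m=z'$ of factorizations of $a$ with $\mathsf d(z_{i-1},z_i)\le N$ for all $i$. Then $R^\bullet$ is atomic, and the following hold. 1. $\rho(R^\bullet)<\infty$, and $\rho_k(R^\bullet)<\infty$ for all $k$. 2. $\mathsf c_{\mathsf d}(R^\bullet)<\infty$ for every distance $\mathsf d$ on $R^\bullet$. More precisely, there exist a surjective valuation $v\colon A\to\mathbb Z\cup\{\infty\}$ that is non-negative on $D$ and a least $n\in\mathbb N_0$ with $\{x\in A: v(x)\ge n\}\subseteq R$, and for all such $v$ and $n$ one has $\mathsf c_{\mathsf d}(R^\bullet)\le 3\max\{n,1\}-1$ for every distance $\mathsf d$ on $R^\bullet$. 3. $\Delta(R^\bullet)$ is finite. 4. There is $M\in\mathbb N$ such that $\rho_k(R^\bullet)-\rho_{k-1}(R^\bullet)\le M$ for all $k\ge 2$. 5. The Structure Theorem for Unions of Sets of Lengths holds for $R^\bullet$: there are $d\in\mathbb N$ and $k^*,M^*\in\mathbb N_0$ such that for all $k\ge k^*$ the set $L=\mathcal U_k(R^\bullet)$ is an almost arithmetical progression with difference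 $d$ and bound $M^*$, that is, $L\subseteq\min L+d\mathbb Z$ and $L\cap[\min L+M^*,\sup L-M^*]=(\min L+d\mathbb Z)\cap[\min L+M^*,\sup L-M^*]$. -/

import Mathlib

open scoped TensorProduct ENNReal

noncomputable section

namespace RigidFact

/-! ### Cancellative elements and atoms -/

/-- The submonoid of cancellative elements of a multiplicative monoid. -/
def cancellative (M : Type*) [Monoid M] : Submonoid M where
  carrier := {x | IsRegular x}
  one_mem' := isRegular_one
  mul_mem' := fun ha hb => ⟨ha.left.mul hb.left, ha.right.mul hb.right⟩

section Monoid

variable (H : Type*) [Monoid H]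

/-- The atoms of `H`: the non-units `u` such that `u = a * b` forces `a` or `b` to be a unit. -/
abbrev Atom : Type _ := {u : H // Irreducible u}

/-- `H` is atomic: every non-unit is a product of finitely many atoms. -/
def IsAtomicMonoid : Prop :=
  ∀ a : H, ¬ IsUnit a → ∃ l : List (Atom H), (l.map Subtype.val).prod = a

/-- Pairs `(ε, u₁ ⋯ u_k)` of a unit and a word in the free monoid on the atoms. -/
abbrev PreFactorization : Type _ := Hˣ × List (Atom H)

variable {H}

/-- The atom `u * ε`, for an atom `u` and a unit `ε`. -/
def Atom.mulUnit (u : Atom H) (ε : Hˣ) : Atom H :=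
  ⟨(u : H) * (ε : H), (irreducible_mul_units ε).2 u.2⟩

namespace PreFactorization

/-- The product `ε u₁ ⋯ u_k` in `H`. -/
def eval (x : PreFactorization H) : H := (x.1 : H) * (x.2.map Subtype.val).prod

/-- `(ε, u₁ ⋯ u_k) (ε', v₁ ⋯ v_l) = (ε, u₁ ⋯ (u_k ε') v₁ ⋯ v_l)` if `k > 0`, and
`(ε, 1) (ε', v₁ ⋯ v_l) = (ε ε', v₁ ⋯ v_l)`. -/
def mul (x y : PreFactorization H) : PreFactorization H :=
  if x.2.length = 0 then (x.1 * y.1, y.2)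
  else (x.1, x.2.modify (x.2.length - 1) (fun u => u.mulUnit y.1) ++ y.2)

/-- The congruence `(ε, u₁ ⋯ u_k) ∼ (ε', v₁ ⋯ v_k)`: there are units `δ₁, …, δ_{k+1}` with
`δ₁ = ε'⁻¹ ε`, `δ_{k+1} = 1` and `v_i = δ_i u_i δ_{i+1}⁻¹` for all `i`. (In the code indices start
at `0`.) For `i = 1` this reads `ε' v₁ = ε u₁ δ₂⁻¹`, for `k = 0` it reads `ε = ε'`, and the equality
of the products `ε u₁ ⋯ u_k = ε' v₁ ⋯ v_k` follows by telescoping. -/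
def Rel (x y : PreFactorization H) : Prop :=
  x.2.length = y.2.length ∧
  ∃ δ : ℕ → Hˣ, δ 0 = y.1⁻¹ * x.1 ∧ δ x.2.length = 1 ∧
    ∀ (i : ℕ) (hx : i < x.2.length) (hy : i < y.2.length),
      (y.2[i] : H) = (δ i : H) * (x.2[i] : H) * ((δ (i + 1))⁻¹ : Hˣ)

theorem rel_equivalence : Equivalence (Rel (H := H)) where
  refl x := ⟨rfl, fun _ => 1, by simp, rfl, by simp⟩
  symm := by
    rintro x y ⟨hl, δ, h0, h1, h⟩
    refine ⟨hl.symm, fun i => (δ i)⁻¹, by simp [h0], by simp [← hl, h1], fun i hy hx => ?_⟩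
    rw [h i hx hy]
    simp [mul_assoc]
  trans := by
    rintro x y z ⟨hl, δ, h0, h1, h⟩ ⟨hl', δ', h0', h1', h'⟩
    refine ⟨hl.trans hl', fun i => δ' i * δ i, ?_, ?_, fun i hx hz => ?_⟩
    · simp [h0, h0', mul_assoc]
    · simp only [h1]
      rw [hl, h1', one_mul]
    · rw [h' i (hl ▸ hx) hz, h i hx (hl ▸ hx)]
      simp [mul_assoc]

theorem prod_eq_of_rel (u v : List (Atom H)) (hl : u.length = v.length) (δ : ℕ → Hˣ)
    (h1 : δ u.length = 1)
    (h : ∀ (i : ℕ) (hx : i < u.length) (hy : i < v.length),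
      (v[i] : H) = (δ i : H) * (u[i] : H) * ((δ (i + 1))⁻¹ : Hˣ)) :
    (v.map Subtype.val).prod = (δ 0 : H) * (u.map Subtype.val).prod := by
  induction u generalizing v δ with
  | nil =>
    obtain rfl : v = [] := by simpa using hl.symm
    simp only [List.length_nil] at h1
    simp [h1]
  | cons a u ih =>
    cases v with
    | nil => simp at hl
    | cons b v =>
      have hb := h 0 (by simp) (by simp)
      have := ih v (by simpa using hl) (fun i => δ (i + 1)) (by simpa using h1)
        (fun i hx hy => h (i + 1) (Nat.succ_lt_succ hx) (Nat.succ_lt_succ hy))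
      simp only [List.getElem_cons_zero] at hb
      simp only [List.map_cons, List.prod_cons, hb, this]
      simp [mul_assoc]

theorem eval_eq_of_rel {x y : PreFactorization H} (h : Rel x y) : eval x = eval y := by
  obtain ⟨hl, δ, h0, h1, h⟩ := h
  rw [eval, eval, prod_eq_of_rel x.2 y.2 hl δ h1 h, h0]
  simp [mul_assoc]

theorem length_mul (x y : PreFactorization H) :
    (mul x y).2.length = x.2.length + y.2.length := by
  unfold mul
  split_ifs with h <;> simp [h]

theorem mul_rel {x x' y y' : PreFactorization H} (hx : Rel x x') (hy : Rel y y') :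
    Rel (mul x y) (mul x' y') := by
  obtain ⟨hl, δ, h0, h1, h⟩ := hx
  obtain ⟨hl', δ', h0', h1', h'⟩ := hy
  refine ⟨by rw [length_mul, length_mul, hl, hl'], ?_⟩
  by_cases hk : x.2.length = 0
  · have hk' : x'.2.length = 0 := hl ▸ hk
    have hε : x'.1 = x.1 := by
      rw [hk, h0] at h1
      exact inv_mul_eq_one.1 h1
    simp only [mul, hk, hk', if_true]
    exact ⟨δ', by simp [h0', hε], h1', h'⟩
  · have hk' : ¬ x'.2.length = 0 := hl ▸ hk
    simp only [mul, hk, hk', if_false]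
    refine ⟨fun i => if i < x.2.length then δ i else δ' (i - x.2.length), ?_, ?_, ?_⟩
    · simp [Nat.pos_of_ne_zero hk, h0]
    · simp [h1']
    · intro i hi hi'
      simp only [List.length_append, List.length_modify] at hi hi'
      by_cases hik : i < x.2.length
      · have hik' : i < x'.2.length := hl ▸ hik
        rw [List.getElem_append_left (by simpa using hik'),
          List.getElem_append_left (by simpa using hik)]
        simp only [List.getElem_modify, hik, if_true]
        by_cases hlast : i + 1 = x.2.length
        · have e1 : x.2.length - 1 = i := by omega
          have e2 : x'.2.length - 1 = i := by omega
          have := h i hik hik'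
          rw [hlast, h1] at this
          simp [e1, e2, hlast, Atom.mulUnit, this, h0', mul_assoc]
        · have e1 : ¬ x.2.length - 1 = i := by omega
          have e2 : ¬ x'.2.length - 1 = i := by omega
          have e3 : i + 1 < x.2.length := by omega
          simpa [e1, e2, e3] using h i hik hik'
      · have hik' : ¬ i < x'.2.length := hl ▸ hik
        have e3 : ¬ i + 1 < x.2.length := by omega
        have e4 : i + 1 - x.2.length = i - x.2.length + 1 := by omega
        rw [List.getElem_append_right (by simpa using hik'),
          List.getElem_append_right (by simpa using hik)]
        simp only [List.length_modify, hik, e3, if_false, e4]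
        simp only [← hl]
        exact h' (i - x.2.length) (by omega) (by omega)

theorem mul_one' (x : PreFactorization H) : mul x (1, []) = x := by
  unfold mul
  split_ifs with h
  · exact Prod.ext (by simp) (by simpa using (List.length_eq_zero_iff.1 h).symm)
  · refine Prod.ext rfl ?_
    have : (fun u : Atom H => u.mulUnit 1) = id := by
      funext u; exact Subtype.ext (by simp [Atom.mulUnit])
    simp [this, List.modify_id]

theorem mul_assoc' (x y z : PreFactorization H) : mul (mul x y) z = mul x (mul y z) := by
  by_cases hx : x.2.length = 0
  · by_cases hy : y.2.length = 0 <;> simp [mul, hx, hy, mul_assoc]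
  · by_cases hy : y.2.length = 0
    · have hy' : y.2 = [] := List.length_eq_zero_iff.1 hy
      have : ((fun u : Atom H => u.mulUnit z.1) ∘ fun u : Atom H => u.mulUnit y.1) =
          fun u : Atom H => u.mulUnit (y.1 * z.1) := by
        funext u; exact Subtype.ext (by simp [Atom.mulUnit, mul_assoc])
      simp [mul, hx, hy', List.modify_modify_eq, this]
    · refine Prod.ext (by simp [mul, hx, hy]) ?_
      have e : x.2.length + y.2.length - 1 = x.2.length + (y.2.length - 1) := by omega
      simp only [mul, hx, hy, if_false, List.length_append, List.length_modify, Nat.add_eq_zero_iff,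
        false_and, e]
      rw [← List.append_assoc]
      congr 1
      apply List.ext_getElem (by simp)
      intro i h1 h2
      by_cases hi : i < x.2.length
      · have : ¬ x.2.length + (y.2.length - 1) = i := by omega
        simp [List.getElem_modify, hi, this]
      · have : (x.2.length + (y.2.length - 1) = i) ↔ y.2.length - 1 = i - x.2.length := by omega
        simp [List.getElem_modify, List.getElem_append, hi, this]

theorem eval_mul (x y : PreFactorization H) : eval (mul x y) = eval x * eval y := by
  by_cases hx : x.2.length = 0
  · have hx' : x.2 = [] := List.length_eq_zero_iff.1 hx
    simp [mul, eval, hx', mul_assoc]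
  · have hm : ∀ (l : List (Atom H)) (ε : Hˣ), ¬ l.length = 0 →
        ((l.modify (l.length - 1) fun u => u.mulUnit ε).map Subtype.val).prod =
          (l.map Subtype.val).prod * (ε : H) := by
      intro l ε hl
      induction l with
      | nil => simp at hl
      | cons a l ih =>
        cases l with
        | nil => simp [Atom.mulUnit]
        | cons b l =>
          have := ih (by simp)
          simp only [List.length_cons, Nat.add_sub_cancel, List.modify_succ_cons, List.map_cons,
            List.prod_cons, mul_assoc] at this ⊢
          rw [this]
    simp only [mul, eval, hx, if_false, List.map_append, List.prod_append, hm x.2 y.1 hx]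
    simp only [mul_assoc]

end PreFactorization

variable (H) in
/-- The congruence on `Hˣ × F(A(H))` that defines rigid factorizations. -/
def rigidSetoid : Setoid (PreFactorization H) where
  r := PreFactorization.Rel
  iseqv := PreFactorization.rel_equivalence

variable (H) in
/-- The monoid `Z*(H)` of rigid factorizations of `H`. -/
def RigidFactorization : Type _ := Quotient (rigidSetoid H)

namespace RigidFactorization

/-- The operation `*` on rigid factorizations. -/
instance : Monoid (RigidFactorization H) where
  mul := Quotient.map₂ PreFactorization.mul
    (fun _ _ hx _ _ hy => PreFactorization.mul_rel hx hy)
  one := Quotient.mk (rigidSetoid H) (1, [])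
  mul_assoc := by
    rintro ⟨x⟩ ⟨y⟩ ⟨z⟩
    exact congrArg (Quotient.mk (rigidSetoid H)) (PreFactorization.mul_assoc' x y z)
  one_mul := by
    rintro ⟨x⟩
    exact congrArg (Quotient.mk (rigidSetoid H)) (by simp [PreFactorization.mul])
  mul_one := by
    rintro ⟨x⟩
    exact congrArg (Quotient.mk (rigidSetoid H)) (PreFactorization.mul_one' x)

/-- The natural homomorphism `π : Z*(H) → H`. -/
def eval : RigidFactorization H →* H where
  toFun := Quotient.lift PreFactorization.eval (fun _ _ h => PreFactorization.eval_eq_of_rel h)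
  map_one' := show PreFactorization.eval (1, []) = 1 by simp [PreFactorization.eval]
  map_mul' := by
    rintro ⟨x⟩ ⟨y⟩
    exact PreFactorization.eval_mul x y

/-- The length of a rigid factorization. -/
def length : RigidFactorization H → ℕ :=
  Quotient.lift (fun x : PreFactorization H => x.2.length) (fun _ _ h => h.1)

end RigidFactorization

open RigidFactorization

/-! ### Invariants defined through lengths -/

/-- The set of lengths `L(a)`. -/
def lengths (a : H) : Set ℕ := {k | ∃ z : RigidFactorization H, eval z = a ∧ length z = k}

/-- The set of distances `Δ(a)`. -/
def distances (a : H) : Set ℕ :=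
  {d | 0 < d ∧ ∃ k ∈ lengths a, ∃ l ∈ lengths a, l = k + d ∧ lengths a ∩ Set.Icc k l = {k, l}}

variable (H) in
/-- The set of distances `Δ(H)`. -/
def setOfDistances : Set ℕ := ⋃ a : H, distances a

variable (H) in
/-- The union `U_k(H)` of the sets of lengths that contain `k`. -/
def unionLengths (k : ℕ) : Set ℕ := {l | ∃ a : H, k ∈ lengths a ∧ l ∈ lengths a}

variable (H) in
/-- The `k`-th elasticity `ρ_k(H) = sup U_k(H)`. -/
def kElasticity (k : ℕ) : ℕ∞ := ⨆ l ∈ unionLengths H k, (l : ℕ∞)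

open Classical in
/-- The elasticity `ρ(a) = sup L(a) / min L(a)` of a non-unit `a`; it is `1` for a unit. -/
def elasticityAt (a : H) : ℝ≥0∞ :=
  if IsUnit a then 1 else (⨆ l ∈ lengths a, (l : ℝ≥0∞)) / ((sInf (lengths a) : ℕ) : ℝ≥0∞)

variable (H) in
/-- The elasticity `ρ(H)`. -/
def elasticity : ℝ≥0∞ := ⨆ a : H, elasticityAt a

/-- `L` is an almost arithmetical progression with difference `d` and bound `M`: it is non-empty,
`L ⊆ min L + dℤ`, and `L` and `min L + dℤ` agree on `[min L + M, sup L - M]`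
(where `x ≤ sup L - M` means that `x + M ≤ sup L`, and `sup L` may be infinite). -/
def IsAAP (L : Set ℕ) (d M : ℕ) : Prop :=
  ∃ m : ℕ, IsLeast L m ∧
    (∀ x ∈ L, (d : ℤ) ∣ (x : ℤ) - (m : ℤ)) ∧
    ∀ x : ℕ, m + M ≤ x → ((x + M : ℕ) : ℕ∞) ≤ (⨆ l ∈ L, (l : ℕ∞)) →
      (d : ℤ) ∣ (x : ℤ) - (m : ℤ) → x ∈ L

variable (H) in
/-- The Structure Theorem for Unions of Sets of Lengths holds for `H`. -/
def StructureTheoremForUnions : Prop :=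
  ∃ d kStar M : ℕ, 0 < d ∧ ∀ k, kStar ≤ k → IsAAP (unionLengths H k) d M

/-! ### Distances between factorizations and catenary degrees -/

variable (H) in
/-- A distance on `H`. It is a function on the pairs of rigid factorizations with the same
product; here it is extended by arbitrary values, which are never used, to all pairs. -/
structure FactorizationDistance where
  /-- The underlying function. -/
  d : RigidFactorization H → RigidFactorization H → ℕ
  refl : ∀ z, d z z = 0
  symm : ∀ z z', eval z = eval z' → d z z' = d z' z
  triangle : ∀ z z' z'', eval z = eval z' → eval z = eval z'' → d z z' ≤ d z z'' + d z'' z'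
  mul_left : ∀ x z z', eval z = eval z' → d (x * z) (x * z') = d z z'
  mul_right : ∀ x z z', eval z = eval z' → d (z * x) (z' * x) = d z z'
  length_le : ∀ z z', eval z = eval z' → |(length z : ℤ) - (length z' : ℤ)| ≤ (d z z' : ℤ)
  le_length : ∀ z z', eval z = eval z' → d z z' ≤ max (max (length z) (length z')) 1

namespace FactorizationDistance

variable (δ : FactorizationDistance H)

/-- There is an `N`-chain of factorizations of `a` between `z` and `z'`. -/
def HasChain (a : H) (N : ℕ∞) (z z' : RigidFactorization H) : Prop :=
  ∃ (n : ℕ) (c : ℕ → RigidFactorization H), c 0 = z ∧ c n = z' ∧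
    (∀ i ≤ n, eval (c i) = a) ∧ ∀ i < n, (δ.d (c i) (c (i + 1)) : ℕ∞) ≤ N

/-- The catenary degree of `a`. -/
def catenaryDegreeAt (a : H) : ℕ∞ :=
  sInf {N | ∀ z z' : RigidFactorization H, eval z = a → eval z' = a → δ.HasChain a N z z'}

/-- The catenary degree of `H` in the distance `δ`. -/
def catenaryDegree : ℕ∞ := ⨆ a : H, δ.catenaryDegreeAt a

end FactorizationDistance

end Monoid

/-! ### Orders -/

section Orders

variable (D K : Type*) {A : Type*} [CommRing D] [Field K] [Ring A] [Algebra D A] [Algebra K A]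

/-- A subring `R ⊇ D` of `A` is a `D`-order if it is a finitely generated `D`-module and
`K R = A`. -/
structure IsOrder (R : Subalgebra D A) : Prop where
  finite : Module.Finite D R
  span_eq_top : Submodule.span K (R : Set A) = ⊤

/-- `v : A → ℤ ∪ {∞}` is a surjective valuation that is non-negative on `D`, and `n` is the least
natural number such that `R` contains all `x` with `v x ≥ n`. -/
structure IsConductorExponent (R : Subalgebra D A) (v : AddValuation A (WithTop ℤ)) (n : ℕ) :
    Prop where
  surjective : Function.Surjective v
  nonneg : ∀ x : D, 0 ≤ v (algebraMap D A x)
  isLeast : IsLeast {n : ℕ | ∀ x : A, ((n : ℤ) : WithTop ℤ) ≤ v x → x ∈ R} n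

/-- The completion of `K` at the maximal ideal of the discrete valuation ring `D`. -/
abbrev Completion [IsDomain D] [IsDiscreteValuationRing D] [Algebra D K]
    [IsFractionRing D K] : Type _ :=
  (IsDiscreteValuationRing.maximalIdeal D).adicCompletion K

end Orders

end RigidFact

end

/-! Over the complete field `K̂` the norm of the division algebra `Â`, followed by the valuation of
`K̂`, is again a valuation. Its restriction to `A` is the valuation of `N(x)`, and normalizing it
gives `v`. Coordinates on a finite-dimensional normed space are bounded on the unit ball, so `R`
contains all elements of large value. Hence `v` and `n` exist; the completion serves only this
purpose.

For any such `v` and `n`, finiteness of `R` over `D` makes `v` non-negative on `R`, and a chain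
condition makes elements of value zero units of `R`. With `N = max n 1`, the restriction `V` of `v`
to `R^•` is additive, vanishes exactly at units, attains `N`, and `V a + N ≤ V b` puts `b` in `a
R^•`. This is `IsValuedWithin`; everything else follows from it and left cancellation.

Atoms have values between `1` and `2N - 1`, so length and value are comparable, which bounds
elasticities. For the catenary degree, fix an atom `u` of value at most `N`: a short prefix of any
long factorization can be rewritten to begin with `u`, and cancelling `u` allows induction
(`reflTransGen_step`). Each rewriting involves at most `3N - 1` atoms on either side, which bounds
every distance and also the gaps in sets of lengths. Trading one atom against `4N` atoms bounds the
growth of `ρ_k`, and from this bound the structure of unions is pure combinatorics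
(`exists_isAAP_of_unions`). -/

section NormOfDivisionAlgebra

/-! ### Norms on division algebras over complete fields -/

open Module Polynomial

/-- The norm of an element of a finite-dimensional division algebra is, up to sign, a positive
power of the constant coefficient of its minimal polynomial. -/
theorem exists_norm_eq_pow_coeff_zero_minpoly (F : Type*) {B : Type*} [Field F] [DivisionRing B]
    [Algebra F B] [FiniteDimensional F B] (y : B) :
    ∃ m j : ℕ, 0 < m ∧ Algebra.norm F y = ((-1) ^ j * (minpoly F y).coeff 0) ^ m := by
  have hy : IsIntegral F y := .of_finite F y
  have : Fact (Irreducible (minpoly F y)) := ⟨minpoly.irreducible hy⟩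
  let e : AdjoinRoot (minpoly F y) →+* B :=
    (Ideal.Quotient.liftₐ (Ideal.span {minpoly F y}) (aeval y) (by
      intro a ha
      obtain ⟨b, rfl⟩ := Ideal.mem_span_singleton.1 ha
      simp)).toRingHom
  have he : e (AdjoinRoot.root (minpoly F y)) = y := by
    change aeval y X = y
    simp
  have heF (c : F) : e (algebraMap F _ c) = algebraMap F B c := by
    change aeval y (C c) = _
    simp
  -- `B` is only a left vector space over `F(y)`, as `y` need not be central. Left multiplication by
  -- `y` is a scalar there, so its determinant over `F` is the norm of `y` from `F(y)` to the power
  -- `[B : F(y)]`.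
  let : Module (AdjoinRoot (minpoly F y)) B := Module.compHom B e
  have hsm (a : AdjoinRoot (minpoly F y)) (b : B) : a • b = e a * b := rfl
  have : IsScalarTower F (AdjoinRoot (minpoly F y)) B := by
    refine ⟨fun c a b => ?_⟩
    rw [hsm, hsm, Algebra.smul_def, map_mul, heF, Algebra.smul_def, mul_assoc]
  have : FiniteDimensional (AdjoinRoot (minpoly F y)) B := Module.Finite.right F _ _
  let pb := AdjoinRoot.powerBasis (minpoly.ne_zero hy)
  refine ⟨finrank (AdjoinRoot (minpoly F y)) B, pb.dim, finrank_pos, ?_⟩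
  have hdet : LinearMap.det ((LinearMap.lsmul (AdjoinRoot (minpoly F y)) B
      (AdjoinRoot.root (minpoly F y))).restrictScalars F) = Algebra.norm F y := by
    rw [Algebra.norm_apply]
    congr 1
    ext b
    simp [hsm, he]
  have hlsmul : LinearMap.lsmul (AdjoinRoot (minpoly F y)) B (AdjoinRoot.root (minpoly F y)) =
      AdjoinRoot.root (minpoly F y) • LinearMap.id := by
    ext b
    simp
  rw [← hdet, LinearMap.det_restrictScalars, hlsmul, LinearMap.det_smul, LinearMap.det_id, mul_one,
    map_pow]
  have hpb := Algebra.PowerBasis.norm_gen_eq_coeff_zero_minpoly pb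
  rw [AdjoinRoot.powerBasis_gen, AdjoinRoot.minpoly_root (minpoly.ne_zero hy),
    (minpoly.monic hy).leadingCoeff] at hpb
  rw [hpb]
  simp

theorem rpow_le_one_iff_of_pos {x r : ℝ} (hx : 0 ≤ x) (hr : 0 < r) : x ^ r ≤ 1 ↔ x ≤ 1 := by
  simpa using Real.rpow_le_rpow_iff hx zero_le_one hr

section Complete

variable {F B : Type*} [NontriviallyNormedField F] [IsUltrametricDist F] [CompleteSpace F]
  [DivisionRing B] [Algebra F B] [FiniteDimensional F B]

omit [IsUltrametricDist F] [CompleteSpace F] in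
theorem norm_algebraNorm_le_one_iff (y : B) :
    ‖Algebra.norm F y‖ ≤ 1 ↔ ‖(minpoly F y).coeff 0‖ ≤ 1 := by
  obtain ⟨m, j, hm, h⟩ := exists_norm_eq_pow_coeff_zero_minpoly F y
  rw [h]
  simp [pow_le_one_iff_of_nonneg, hm.ne']

/-- Both `y` and `1 + y` lie in the commutative field `F(y)`. Over the complete field `F`, the
spectral norm there is a positive power of the absolute value of the constant coefficient of the
minimal polynomial, and it is non-archimedean. -/
theorem norm_algebraNorm_one_add_le_one {y : B} (hy : ‖Algebra.norm F y‖ ≤ 1) :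
    ‖Algebra.norm F (1 + y)‖ ≤ 1 := by
  rw [norm_algebraNorm_le_one_iff] at hy ⊢
  have hi : IsIntegral F y := .of_finite F y
  have : Fact (Irreducible (minpoly F y)) := ⟨minpoly.irreducible hi⟩
  have : FiniteDimensional F (AdjoinRoot (minpoly F y)) :=
    (AdjoinRoot.powerBasis (minpoly.ne_zero hi)).finite
  let e : AdjoinRoot (minpoly F y) →ₐ[F] B :=
    Ideal.Quotient.liftₐ (Ideal.span {minpoly F y}) (aeval y) (by
      intro a ha
      obtain ⟨b, rfl⟩ := Ideal.mem_span_singleton.1 ha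
      simp)
  have he : e (AdjoinRoot.root (minpoly F y)) = y := by
    change aeval y X = y
    simp
  have hmin (x : AdjoinRoot (minpoly F y)) :
      spectralNorm F (AdjoinRoot (minpoly F y)) x ≤ 1 ↔ ‖(minpoly F (e x)).coeff 0‖ ≤ 1 := by
    rw [spectralNorm.spectralNorm_eq_norm_coeff_zero_rpow,
      minpoly.algHom_eq e e.toRingHom.injective x]
    have hpos := minpoly.natDegree_pos (A := F) (Algebra.IsIntegral.isIntegral x)
    exact rpow_le_one_iff_of_pos (norm_nonneg _) (by positivity)
  have h1 := (hmin (AdjoinRoot.root _)).2 (by rwa [he])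
  have h2 := (hmin (1 + AdjoinRoot.root _)).1 ((isNonarchimedean_spectralNorm _ _).trans
    (max_le spectralNorm_one.le h1))
  rwa [map_add, map_one, he] at h2

theorem norm_algebraNorm_add_le (x y : B) :
    ‖Algebra.norm F (x + y)‖ ≤ max ‖Algebra.norm F x‖ ‖Algebra.norm F y‖ := by
  wlog hxy : ‖Algebra.norm F y‖ ≤ ‖Algebra.norm F x‖ generalizing x y
  · rw [add_comm, max_comm]
    exact this y x (le_of_not_ge hxy)
  rw [max_eq_left hxy]
  rcases eq_or_ne x 0 with rfl | hx
  · simpa using hxy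
  have hN : Algebra.norm F x ≠ 0 := Algebra.norm_ne_zero_iff.2 hx
  have : x + y = x * (1 + x⁻¹ * y) := by rw [mul_add, mul_one, mul_inv_cancel_left₀ hx]
  rw [this, map_mul, norm_mul]
  refine mul_le_of_le_one_right (norm_nonneg _) (norm_algebraNorm_one_add_le_one ?_)
  have h1 : Algebra.norm F x * Algebra.norm F (x⁻¹ * y) = Algebra.norm F y := by
    rw [← map_mul, mul_inv_cancel_left₀ hx]
  have h2 := congrArg norm h1
  rw [norm_mul] at h2
  rw [← h2] at hxy
  exact (mul_le_iff_le_one_right (norm_pos_iff.2 hN)).1 hxy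

/-- The coordinates of the elements of a finite-dimensional division algebra over a complete field
whose norm is at most one are bounded. -/
theorem exists_norm_repr_le_of_norm_algebraNorm_le_one {ι : Type*} [Finite ι]
    (b : Basis ι F B) :
    ∃ C : ℝ, ∀ x : B, ‖Algebra.norm F x‖ ≤ 1 → ∀ i, ‖b.repr x i‖ ≤ C := by
  have := Fintype.ofFinite ι
  set r : ℝ := (finrank F B : ℝ) with hr
  have hr0 : 0 < r := by rw [hr]; exact_mod_cast finrank_pos
  have hmax (s t : ℝ) (hs : 0 ≤ s) (ht : 0 ≤ t) : (max s t) ^ r⁻¹ ≤ s ^ r⁻¹ + t ^ r⁻¹ := by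
    have h1 := Real.rpow_nonneg hs r⁻¹
    have h2 := Real.rpow_nonneg ht r⁻¹
    rcases max_choice s t with h | h <;> rw [h] <;> linarith
  -- A scalar `c` has norm `c ^ r` for `r` the dimension, so the exponent `r⁻¹` gives homogeneity of
  -- degree one. The coordinates are then continuous, and their operator norms bound them on the
  -- unit ball.
  let : Norm B := ⟨fun x => ‖Algebra.norm F x‖ ^ r⁻¹⟩
  have hdef (x : B) : ‖x‖ = ‖Algebra.norm F x‖ ^ r⁻¹ := rfl
  have core : NormedSpace.Core F B :=
    { norm_nonneg := fun x => Real.rpow_nonneg (norm_nonneg _) _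
      norm_smul := fun c x => by
        rw [hdef, hdef, Algebra.smul_def, map_mul, Algebra.norm_algebraMap, norm_mul, norm_pow,
          Real.mul_rpow (by positivity) (by positivity), ← Real.rpow_natCast, ← Real.rpow_mul
          (norm_nonneg _), ← hr, mul_inv_cancel₀ hr0.ne', Real.rpow_one]
      norm_triangle := fun x y => by
        rw [hdef, hdef, hdef]
        exact (Real.rpow_le_rpow (norm_nonneg _) (norm_algebraNorm_add_le x y)
          (by positivity)).trans (hmax _ _ (norm_nonneg _) (norm_nonneg _))
      norm_eq_zero_iff := fun x => by
        rw [hdef, Real.rpow_eq_zero (norm_nonneg _) (by positivity), norm_eq_zero,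
          Algebra.norm_eq_zero_iff] }
  let : NormedAddCommGroup B := NormedAddCommGroup.ofCore core
  let : NormedSpace F B := NormedSpace.ofCore core
  refine ⟨∑ i, ‖LinearMap.toContinuousLinearMap (b.coord i)‖, fun x hx i => ?_⟩
  have hx1 : ‖x‖ ≤ 1 := (rpow_le_one_iff_of_pos (norm_nonneg _) (by positivity)).2 hx
  calc ‖b.repr x i‖ = ‖LinearMap.toContinuousLinearMap (b.coord i) x‖ := rfl
    _ ≤ ‖LinearMap.toContinuousLinearMap (b.coord i)‖ * ‖x‖ := ContinuousLinearMap.le_opNorm _ _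
    _ ≤ ‖LinearMap.toContinuousLinearMap (b.coord i)‖ :=
      mul_le_of_le_one_right (norm_nonneg _) hx1
    _ ≤ _ := Finset.single_le_sum (f := fun i => ‖LinearMap.toContinuousLinearMap (b.coord i)‖)
      (fun _ _ => norm_nonneg _) (Finset.mem_univ i)

end Complete

end NormOfDivisionAlgebra

/-! ### Existence of the valuation and of the conductor exponent -/

section ExistsValuation

open Module IsDedekindDomain
open scoped WithZero

/-- A non-zero integer-valued valuation of a division ring can be normalized to be surjective. -/
theorem exists_surjective_addValuation {A : Type*} [DivisionRing A] (w : A → ℤ)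
    (hmul : ∀ x y, x ≠ 0 → y ≠ 0 → w (x * y) = w x + w y)
    (hadd : ∀ x y, x ≠ 0 → y ≠ 0 → x + y ≠ 0 → min (w x) (w y) ≤ w (x + y))
    (hne : ∃ x, x ≠ 0 ∧ w x ≠ 0) :
    ∃ (v : AddValuation A (WithTop ℤ)) (g : ℤ), 0 < g ∧ Function.Surjective v ∧
      ∀ x, x ≠ 0 → ∃ k : ℤ, v x = k ∧ w x = g * k := by
  have h1 : w 1 = 0 := by
    have := hmul 1 1 one_ne_zero one_ne_zero
    rw [mul_one] at this
    omega
  have hinv (x : A) (hx : x ≠ 0) : w x⁻¹ = -w x := by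
    have := hmul x x⁻¹ hx (inv_ne_zero hx)
    rw [mul_inv_cancel₀ hx, h1] at this
    omega
  let S : AddSubgroup ℤ :=
    { carrier := {k | ∃ x, x ≠ 0 ∧ w x = k}
      zero_mem' := ⟨1, one_ne_zero, h1⟩
      add_mem' := by
        rintro _ _ ⟨x, hx, rfl⟩ ⟨y, hy, rfl⟩
        exact ⟨x * y, mul_ne_zero hx hy, hmul x y hx hy⟩
      neg_mem' := by
        rintro _ ⟨x, hx, rfl⟩
        exact ⟨x⁻¹, inv_ne_zero hx, hinv x hx⟩ }
  obtain ⟨g, hg0, hg⟩ : ∃ g : ℤ, 0 < g ∧ ∀ k, k ∈ S ↔ g ∣ k := by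
    obtain ⟨a, ha⟩ := Int.subgroup_cyclic S
    have hmem (k : ℤ) : k ∈ S ↔ a ∣ k := by
      rw [ha, ← AddSubgroup.zmultiples_eq_closure, Int.mem_zmultiples_iff]
    obtain ⟨x, hx, hwx⟩ := hne
    have ha0 : a ≠ 0 := by
      rintro rfl
      exact hwx (zero_dvd_iff.1 ((hmem _).1 ⟨x, hx, rfl⟩))
    exact ⟨|a|, abs_pos.2 ha0, fun k => by rw [hmem, abs_dvd]⟩
  have hu (x : A) : ∃ k : ℤ, x ≠ 0 → w x = g * k := by
    by_cases hx : x = 0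
    · exact ⟨0, fun h => absurd hx h⟩
    · obtain ⟨k, hk⟩ := (hg (w x)).1 ⟨x, hx, rfl⟩
      exact ⟨k, fun _ => hk⟩
  choose u hu using hu
  classical
  let f : A → WithTop ℤ := fun x => if x = 0 then ⊤ else (u x : WithTop ℤ)
  have hf (x : A) (hx : x ≠ 0) : f x = (u x : WithTop ℤ) := if_neg hx
  have hf0 : f 0 = ⊤ := if_pos rfl
  let v : AddValuation A (WithTop ℤ) := AddValuation.of f hf0
    (by
      have := hu 1 one_ne_zero
      rw [h1, eq_comm, mul_eq_zero, or_iff_right hg0.ne'] at this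
      rw [hf _ one_ne_zero, this]
      rfl)
    (by
      intro x y
      rcases eq_or_ne x 0 with rfl | hx
      · rw [zero_add]
        exact min_le_right _ _
      rcases eq_or_ne y 0 with rfl | hy
      · rw [add_zero]
        exact min_le_left _ _
      rcases eq_or_ne (x + y) 0 with hxy | hxy
      · rw [hxy, hf0]
        exact le_top
      · rw [hf x hx, hf y hy, hf _ hxy, min_le_iff, WithTop.coe_le_coe, WithTop.coe_le_coe]
        have := hadd x y hx hy hxy
        rw [hu x hx, hu y hy, hu _ hxy, min_le_iff] at this
        exact this.imp (fun h => le_of_mul_le_mul_left h hg0)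
          (fun h => le_of_mul_le_mul_left h hg0))
    (by
      intro x y
      rcases eq_or_ne x 0 with rfl | hx
      · rw [zero_mul, hf0, WithTop.top_add]
      rcases eq_or_ne y 0 with rfl | hy
      · rw [mul_zero, hf0, WithTop.add_top]
      rw [hf x hx, hf y hy, hf _ (mul_ne_zero hx hy), ← WithTop.coe_add, WithTop.coe_inj]
      have := hmul x y hx hy
      rw [hu x hx, hu y hy, hu _ (mul_ne_zero hx hy), ← mul_add] at this
      exact mul_left_cancel₀ hg0.ne' this)
  have hv (x : A) (hx : x ≠ 0) : v x = (u x : WithTop ℤ) := hf x hx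
  refine ⟨v, g, hg0, fun k => ?_, fun x hx => ⟨u x, hv x hx, hu x hx⟩⟩
  induction k using WithTop.recTopCoe with
  | top => exact ⟨0, v.map_zero⟩
  | coe k =>
    obtain ⟨x, hx, hwx⟩ := (hg (g * k)).2 (dvd_mul_right g k)
    refine ⟨x, (hv x hx).trans ?_⟩
    rw [hu x hx] at hwx
    rw [mul_left_cancel₀ hg0.ne' hwx]

theorem algebraNorm_one_tmul (F : Type*) {K A : Type*} [Field K] [Field F] [Algebra K F] [Ring A]
    [Algebra K A] [FiniteDimensional K A] (x : A) :
    Algebra.norm F ((1 : F) ⊗ₜ[K] x) = algebraMap K F (Algebra.norm K x) := by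
  rw [Algebra.norm_apply, Algebra.norm_apply, ← LinearMap.det_baseChange]
  congr 1
  ext a
  simp

namespace RigidFact

variable {D K A : Type*} [CommRing D] [IsDomain D] [IsDiscreteValuationRing D]
  [Field K] [Algebra D K] [IsFractionRing D K]
  [DivisionRing A] [Algebra K A] [FiniteDimensional K A]

/-- Both parts descend from the completed algebra along `x ↦ 1 ⊗ x`, because the norm commutes with
base change and `K → K̂` preserves the valuation. -/
theorem valuation_algebraNorm_completion
    (hA : ∀ x : A ⊗[K] Completion D K, x ≠ 0 → IsUnit x) :
    (∀ x y : A, (IsDiscreteValuationRing.maximalIdeal D).valuation K (Algebra.norm K (x + y)) ≤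
      max ((IsDiscreteValuationRing.maximalIdeal D).valuation K (Algebra.norm K x))
        ((IsDiscreteValuationRing.maximalIdeal D).valuation K (Algebra.norm K y))) ∧
    ∀ {ι : Type _} [Finite ι] (b : Basis ι K A), ∃ c : D, c ≠ 0 ∧ ∀ x : A,
      (IsDiscreteValuationRing.maximalIdeal D).valuation K (Algebra.norm K x) ≤ 1 →
      ∀ i, (IsDiscreteValuationRing.maximalIdeal D).valuation K
        (algebraMap D K c * b.repr x i) ≤ 1 := by
  set val := (IsDiscreteValuationRing.maximalIdeal D).valuation K with hval
  let _ : (Valued.v : Valuation (Completion D K) ℤᵐ⁰).RankOne :=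
    Valuation.IsRankOneDiscrete.rankOne _ (e := 2) one_lt_two
  let _ : NontriviallyNormedField (Completion D K) :=
    Valued.toNontriviallyNormedField (Completion D K) ℤᵐ⁰
  let _ : DivisionRing (Completion D K ⊗[K] A) := DivisionRing.ofIsUnitOrEqZero (fun x => by
    by_cases hx : x = 0
    · exact Or.inr hx
    · left
      have e := Algebra.TensorProduct.comm K (Completion D K) A
      exact (MulEquiv.isUnit_map e).1 (hA (e x) (by simpa using hx)))
  have hv (a : K) : Valued.v (algebraMap K (Completion D K) a) = val a :=
    HeightOneSpectrum.adicCompletion.valued_coe _ _ a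
  have hle (a b : K) : ‖algebraMap K (Completion D K) a‖ ≤ ‖algebraMap K (Completion D K) b‖ ↔
      val a ≤ val b := by
    rw [Valued.toNormedField.norm_le_iff, hv, hv]
  have hle1 (a : K) : ‖algebraMap K (Completion D K) a‖ ≤ 1 ↔ val a ≤ 1 := by
    rw [Valued.toNormedField.norm_le_one_iff, hv]
  refine ⟨fun x y => ?_, fun {ι} _ b => ?_⟩
  · have := norm_algebraNorm_add_le (F := Completion D K) ((1 : Completion D K) ⊗ₜ[K] x)
      ((1 : Completion D K) ⊗ₜ[K] y)
    rw [← TensorProduct.tmul_add, algebraNorm_one_tmul, algebraNorm_one_tmul,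
      algebraNorm_one_tmul, le_max_iff, hle, hle] at this
    exact le_max_iff.2 this
  · obtain ⟨C, hC⟩ := exists_norm_repr_le_of_norm_algebraNorm_le_one
      (Algebra.TensorProduct.basis (Completion D K) b)
    obtain ⟨p, hp⟩ := IsDiscreteValuationRing.exists_irreducible D
    have hp1 : ‖algebraMap K (Completion D K) (algebraMap D K p)‖ < 1 := by
      rw [Valued.toNormedField.norm_lt_one_iff, hv, HeightOneSpectrum.valuation_lt_one_iff_mem]
      exact (IsLocalRing.mem_maximalIdeal p).2 hp.not_isUnit
    -- A high power of a uniformizer absorbs the real bound `C`; the maximum with `1` ensures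
    -- positivity.
    obtain ⟨m, hm⟩ := exists_pow_lt_of_lt_one (show (0 : ℝ) < (max C 1)⁻¹ by positivity) hp1
    refine ⟨p ^ m, pow_ne_zero _ hp.ne_zero, fun x hx i => ?_⟩
    have hx' := hC ((1 : Completion D K) ⊗ₜ[K] x) (by rwa [algebraNorm_one_tmul, hle1]) i
    rw [Algebra.TensorProduct.basis_repr_tmul] at hx'
    simp only [one_smul, Finsupp.mapRange_apply] at hx'
    rw [← hle1, map_mul, norm_mul, map_pow, map_pow, norm_pow]
    calc _ ≤ (max C 1)⁻¹ * max C 1 := by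
          gcongr
          exact hx'.trans (le_max_left _ _)
      _ = 1 := inv_mul_cancel₀ (by positivity)

/-- The valuation is the normalized negative logarithm of the valuation of the norm. With a basis of
`A` taken inside `R`, one `c` in `D` clears the denominators of all `x` with `v x ≥ 0`, so `c * x ∈
R`; hence the exponent `v c` works, and a least one exists. -/
theorem exists_isConductorExponent [Algebra D A] [IsScalarTower D K A]
    (hA : ∀ x : A ⊗[K] Completion D K, x ≠ 0 → IsUnit x)
    (R : Subalgebra D A) (hR : IsOrder D K R) :
    ∃ (v : AddValuation A (WithTop ℤ)) (n : ℕ), IsConductorExponent D R v n := by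
  classical
  obtain ⟨hadd, hbdd⟩ := valuation_algebraNorm_completion hA
  set val := (IsDiscreteValuationRing.maximalIdeal D).valuation K with hval
  have hne (x : A) (hx : x ≠ 0) : val (Algebra.norm K x) ≠ 0 :=
    (Valuation.ne_zero_iff _).2 (Algebra.norm_ne_zero_iff.2 hx)
  have hD (a : D) : val (Algebra.norm K (algebraMap D A a)) =
      val (algebraMap D K a) ^ finrank K A := by
    rw [IsScalarTower.algebraMap_apply D K A, Algebra.norm_algebraMap, map_pow]
  have hrank : finrank K A ≠ 0 := finrank_pos.ne'
  have hinj (a : D) (ha : a ≠ 0) : algebraMap D A a ≠ 0 := by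
    rw [IsScalarTower.algebraMap_apply D K A]
    simpa using ha
  obtain ⟨v, g, hg, hsurj, hv⟩ := exists_surjective_addValuation
    (fun x : A => -(val (Algebra.norm K x)).log)
    (fun x y hx hy => by
      rw [map_mul, map_mul, WithZero.log_mul (hne x hx) (hne y hy)]
      ring)
    (fun x y hx hy hxy => by
      rw [min_le_iff, neg_le_neg_iff, neg_le_neg_iff, WithZero.log_le_log (hne _ hxy) (hne _ hx),
        WithZero.log_le_log (hne _ hxy) (hne _ hy)]
      exact le_max_iff.1 (hadd x y))
    (by
      obtain ⟨p, hp⟩ := IsDiscreteValuationRing.exists_irreducible D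
      refine ⟨algebraMap D A p, hinj p hp.ne_zero, fun h => ?_⟩
      rw [hD, WithZero.log_pow, neg_eq_zero, smul_eq_zero, or_iff_right hrank] at h
      have h1 : val (algebraMap D K p) < 1 := by
        rw [HeightOneSpectrum.valuation_lt_one_iff_mem]
        exact (IsLocalRing.mem_maximalIdeal p).2 hp.not_isUnit
      have h0 : val (algebraMap D K p) ≠ 0 := by simpa [hval] using hp.ne_zero
      rw [← WithZero.exp_log h0, h] at h1
      exact lt_irrefl _ h1)
  have hv1 (x : A) (hx : x ≠ 0) : 0 ≤ v x ↔ val (Algebra.norm K x) ≤ 1 := by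
    obtain ⟨k, hk, hk'⟩ := hv x hx
    rw [hk, ← WithZero.log_le_log (hne x hx) one_ne_zero, WithZero.log_one]
    have : (0 : WithTop ℤ) ≤ (k : WithTop ℤ) ↔ 0 ≤ k := by exact_mod_cast Iff.rfl
    rw [this]
    constructor
    · intro h
      have := mul_nonneg hg.le h
      linarith
    · intro h
      exact nonneg_of_mul_nonneg_right (by linarith) hg
  have hvD (a : D) : 0 ≤ v (algebraMap D A a) := by
    by_cases ha : a = 0
    · simp [ha]
    · rw [hv1 _ (hinj a ha), hD]
      exact pow_le_one' (HeightOneSpectrum.valuation_le_one _ _) _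
  let b := Basis.ofSpan (K := K) (s := (R : Set A)) hR.span_eq_top.ge
  have hb (i) : b i ∈ R := Basis.ofSpan_subset (K := K) (s := (R : Set A)) hR.span_eq_top.ge
    ⟨i, rfl⟩
  have := Module.Finite.finite_basis b
  have := Fintype.ofFinite ((linearIndepOn_empty K (id : A → A)).extend
    (Set.empty_subset (R : Set A)))
  obtain ⟨c, hc, hcx⟩ := hbdd b
  have hcR (x : A) (hx : val (Algebra.norm K x) ≤ 1) : algebraMap D A c * x ∈ R := by
    rw [← b.sum_repr x, Finset.mul_sum]
    refine Subalgebra.sum_mem _ fun i _ => ?_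
    obtain ⟨d, hd⟩ := IsDiscreteValuationRing.exists_lift_of_le_one (hcx x hx i)
    rw [IsScalarTower.algebraMap_apply D K A, ← Algebra.smul_def, smul_smul, ← hd,
      algebraMap_smul]
    exact R.smul_mem (hb i) d
  have hex : ∃ n : ℕ, ∀ x : A, ((n : ℤ) : WithTop ℤ) ≤ v x → x ∈ R := by
    obtain ⟨k, hk, -⟩ := hv _ (hinj c hc)
    have hk0 : 0 ≤ k := by
      have := hvD c
      rw [hk] at this
      exact_mod_cast this
    lift k to ℕ using hk0
    refine ⟨k, fun x hx => ?_⟩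
    by_cases hx0 : x = 0
    · rw [hx0]
      exact R.zero_mem
    have hcinv := mul_inv_cancel_left₀ (hinj c hc) x
    have hne' : (algebraMap D A c)⁻¹ * x ≠ 0 := mul_ne_zero (inv_ne_zero (hinj c hc)) hx0
    rw [← hcinv]
    refine hcR _ ((hv1 _ hne').1 ?_)
    rw [← hcinv, v.map_mul, hk] at hx
    by_contra hlt
    obtain ⟨j, hj, -⟩ := hv _ hne'
    rw [hj] at hx hlt
    norm_cast at hx hlt
    omega
  exact ⟨v, sInf {n : ℕ | ∀ x : A, ((n : ℤ) : WithTop ℤ) ≤ v x → x ∈ R}, hsurj, hvD,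
    Nat.sInf_mem hex, fun m hm => Nat.sInf_le hm⟩

end RigidFact

end ExistsValuation

namespace RigidFact

/-! ### Combinatorics of unions of sets of lengths -/

section UnionsOfSets

/-- The Structure Theorem for Unions, for an abstract family of unions of sets of lengths whose
maxima grow by a bounded amount in each step. -/
theorem exists_isAAP_of_unions (U : ℕ → Set ℕ) (C M : ℕ) (hself : ∀ k, k ∈ U k)
    (hsymm : ∀ k l, l ∈ U k → k ∈ U l)
    (hadd : ∀ k l k' l', l ∈ U k → l' ∈ U k' → l + l' ∈ U (k + k'))
    (hbdd : ∀ k, ∀ l ∈ U k, l ≤ C * k)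
    (hstep : ∀ k, ∀ l ∈ U (k + 1), ∃ l' ∈ U k, l ≤ l' + M) :
    ∃ d kStar B : ℕ, 0 < d ∧ ∀ k, kStar ≤ k → IsAAP (U k) d B := by
  have hmax (k : ℕ) : ∃ r ∈ U k, ∀ l ∈ U k, l ≤ r :=
    ⟨sSup (U k), Nat.sSup_mem ⟨k, hself k⟩ ⟨C * k, hbdd k⟩,
      fun l hl => le_csSup ⟨C * k, hbdd k⟩ hl⟩
  choose ρ hρ hρmax using hmax
  have hsup (k : ℕ) : (⨆ l ∈ U k, (l : ℕ∞)) = ρ k :=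
    le_antisymm (iSup₂_le fun l hl => by exact_mod_cast hρmax k l hl)
      (le_iSup₂_of_le (ρ k) (hρ k) le_rfl)
  have hρ0 : ρ 0 = 0 := by simpa using hbdd 0 _ (hρ 0)
  have hρstep (k : ℕ) : ρ (k + 1) ≤ ρ k + M := by
    obtain ⟨l, hl, h⟩ := hstep k _ (hρ (k + 1))
    exact h.trans (Nat.add_le_add_right (hρmax k l hl) M)
  have hρadd (k j : ℕ) : ρ (k + j) ≤ ρ k + j * M := by
    induction j with
    | zero => simp
    | succ j ih =>
      have := hρstep (k + j)
      rw [← add_assoc, Nat.succ_mul]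
      omega
  have hρmono : Monotone ρ := monotone_nat_of_le_succ fun k =>
    (Nat.le_succ _).trans (hρmax (k + 1) _ (hadd _ _ _ _ (hρ k) (hself 1)))
  have hleast (k : ℕ) : ∃ m, IsLeast (U k) m :=
    ⟨sInf (U k), Nat.sInf_mem ⟨k, hself k⟩, fun l hl => Nat.sInf_le hl⟩
  -- The differences `l - k` with `l ∈ U k` form a group by additivity and symmetry; its generator
  -- is the difference of the progression.
  let S : AddSubgroup ℤ :=
    { carrier := {x | ∃ k l : ℕ, l ∈ U k ∧ (l : ℤ) - k = x}
      zero_mem' := ⟨0, 0, hself 0, by simp⟩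
      add_mem' := by
        rintro _ _ ⟨k, l, h, rfl⟩ ⟨k', l', h', rfl⟩
        exact ⟨k + k', l + l', hadd _ _ _ _ h h', by push_cast; ring⟩
      neg_mem' := by
        rintro _ ⟨k, l, h, rfl⟩
        exact ⟨l, k, hsymm _ _ h, by ring⟩ }
  obtain ⟨d, hd⟩ : ∃ d : ℕ, ∀ x, x ∈ S ↔ (d : ℤ) ∣ x := by
    obtain ⟨a, ha⟩ := Int.subgroup_cyclic S
    refine ⟨a.natAbs, fun x => ?_⟩
    rw [ha, ← AddSubgroup.zmultiples_eq_closure, Int.mem_zmultiples_iff, Int.natAbs_dvd]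
  have hdvd (k l : ℕ) (h : l ∈ U k) : (d : ℤ) ∣ (l : ℤ) - k := (hd _).1 ⟨k, l, h, rfl⟩
  rcases Nat.eq_zero_or_pos d with rfl | hd0
  · refine ⟨1, 0, 0, one_pos, fun k _ => ?_⟩
    have hU (l : ℕ) (hl : l ∈ U k) : l = k := by
      have := hdvd k l hl
      rw [Nat.cast_zero, zero_dvd_iff] at this
      omega
    refine ⟨k, ⟨hself k, fun l hl => (hU l hl).ge⟩, by simp, fun x hx hx' _ => ?_⟩
    rw [hsup] at hx'
    have h1 : x + 0 ≤ ρ k := by exact_mod_cast hx'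
    have h2 := hU _ (hρ k)
    have h3 : x = k := by omega
    rw [h3]
    exact hself k
  obtain ⟨k₀, hk₀⟩ : ∃ k₀, k₀ + d ∈ U k₀ := by
    obtain ⟨k, l, hl, h⟩ := (hd d).2 dvd_rfl
    have : l = k + d := by omega
    exact ⟨k, this ▸ hl⟩
  have hnsmul (n k l : ℕ) (h : l ∈ U k) : n * l ∈ U (n * k) := by
    induction n with
    | zero => simpa using hself 0
    | succ n ih =>
      rw [Nat.succ_mul, Nat.succ_mul]
      exact hadd _ _ _ _ ih h
  -- Using the basic jump `k₀ → k₀ + d` exactly `j` times and padding the rest trivially produces a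
  -- full window of `M + 1` consecutive terms.
  have hwindow (j : ℕ) (hj : j ≤ M) : M * k₀ + j * d ∈ U (M * k₀) := by
    have := hadd _ _ _ _ (hnsmul j _ _ hk₀) (hself ((M - j) * k₀))
    have e1 : j * k₀ + (M - j) * k₀ = M * k₀ := by rw [← add_mul]; congr 1; omega
    have e2 : j * (k₀ + d) + (M - j) * k₀ = M * k₀ + j * d := by rw [← e1]; ring
    rwa [e1, e2] at this
  generalize hE : M * k₀ = E at hwindow
  -- The values `ρ t + (k - t)` rise by less than `M + 1` per step in `t`, so the last one not
  -- exceeding `x` misses it by at most `M`. That gap is a multiple of `d`, and the window, for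
  -- which `E` is held in reserve, fills it.
  have hupper (k x : ℕ) (hk : E ≤ k) (hkx : k ≤ x) (hx : x ≤ ρ (k - E) + E)
      (hdx : (d : ℤ) ∣ (x : ℤ) - k) : x ∈ U k := by
    classical
    set P : ℕ → Prop := fun t => ρ t + (k - t) ≤ x with hP
    obtain ⟨t, htE, htP, htx⟩ : ∃ t ≤ k - E, P t ∧ x ≤ ρ t + (k - t) + M := by
      refine ⟨Nat.findGreatest P (k - E), Nat.findGreatest_le _,
        Nat.findGreatest_spec (Nat.zero_le _) (by simp [hP, hρ0, hkx]), ?_⟩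
      set t := Nat.findGreatest P (k - E) with ht
      have htle : t ≤ k - E := Nat.findGreatest_le _
      rcases htle.eq_or_lt with h | h
      · rw [h]
        omega
      · have h1 : ¬ P (t + 1) := Nat.findGreatest_is_greatest (Nat.lt_succ_self t) h
        have h2 := hρstep t
        simp only [hP] at h1
        omega
    have h1 : (d : ℤ) ∣ (x : ℤ) - (ρ t + (k - t) : ℕ) := by
      have h2 := dvd_sub hdx (hdvd t _ (hρ t))
      have e : (x : ℤ) - (ρ t + (k - t) : ℕ) = (x : ℤ) - k - ((ρ t : ℤ) - t) := by
        push_cast [Nat.cast_sub (show t ≤ k by omega)]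
        ring
      rwa [e]
    obtain ⟨j, hj⟩ : d ∣ x - (ρ t + (k - t)) := by
      rw [← Nat.cast_sub htP] at h1
      exact_mod_cast h1
    have hjM : j ≤ M := by
      have : j ≤ d * j := Nat.le_mul_of_pos_left j hd0
      omega
    have h3 := hadd _ _ _ _ (hadd _ _ _ _ (hρ t) (hself (k - t - E))) (hwindow j hjM)
    have e1 : t + (k - t - E) + E = k := by omega
    have e2 : ρ t + (k - t - E) + (E + j * d) = x := by
      simp only [hP] at htP
      rw [mul_comm j d]
      omega
    rwa [e1, e2] at h3
  -- Passing from `ρ k` to `ρ (k - E)` costs at most `E * M`; the extra `E` gives `m ≤ x - E` near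
  -- the minimum.
  refine ⟨d, E, E * M + E, hd0, fun k hk => ?_⟩
  obtain ⟨m, hm⟩ := hleast k
  refine ⟨m, hm, fun x hx => ?_, fun x hx hx' hdx => ?_⟩
  · have := dvd_sub (hdvd k x hx) (hdvd k m hm.1)
    rwa [sub_sub_sub_cancel_right] at this
  · rw [hsup] at hx'
    have hx1 : x + (E * M + E) ≤ ρ k := by exact_mod_cast hx'
    have hdk : (d : ℤ) ∣ (x : ℤ) - k := by
      have := dvd_add hdx (hdvd k m hm.1)
      rwa [sub_add_sub_cancel] at this
    rcases le_total k x with hkx | hkx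
    · refine hupper k x hk hkx ?_ hdk
      have := hρadd (k - E) E
      rw [Nat.sub_add_cancel hk] at this
      omega
    -- Below `k` the roles of `x` and `k` are exchanged: `k ∈ U m` gives `k ≤ ρ m ≤ ρ (x - E)`.
    · refine hsymm _ _ (hupper x k (by omega) hkx ?_ ?_)
      · have h1 := hρmax m k (hsymm _ _ hm.1)
        have h2 := hρmono (show m ≤ x - E by omega)
        omega
      · rw [← neg_sub]
        exact hdk.neg_right

end UnionsOfSets

/-! ### Rigid factorizations and local replacement steps -/

section Factorizations

variable {H : Type*} [Monoid H]

namespace RigidFactorization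

/-- The factorization of length zero of a unit. -/
def ofUnit (ε : Hˣ) : RigidFactorization H := Quotient.mk (rigidSetoid H) (ε, [])

/-- The factorization of length one of an atom. -/
def ofAtom (u : Atom H) : RigidFactorization H := Quotient.mk (rigidSetoid H) (1, [u])

@[simp] theorem eval_ofUnit (ε : Hˣ) : eval (ofUnit ε) = (ε : H) :=
  show PreFactorization.eval (ε, []) = (ε : H) by simp [PreFactorization.eval]

@[simp] theorem eval_ofAtom (u : Atom H) : eval (ofAtom u) = (u : H) :=
  show PreFactorization.eval (1, [u]) = (u : H) by simp [PreFactorization.eval]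

@[simp] theorem length_ofAtom (u : Atom H) : length (ofAtom u) = 1 := rfl

@[simp] theorem length_mul (x y : RigidFactorization H) : length (x * y) = length x + length y := by
  obtain ⟨x⟩ := x
  obtain ⟨y⟩ := y
  exact PreFactorization.length_mul x y

@[simp] theorem length_one : length (1 : RigidFactorization H) = 0 := rfl

@[simp] theorem length_pow (x : RigidFactorization H) (n : ℕ) : length (x ^ n) = n * length x := by
  induction n with
  | zero => simp
  | succ n ih => rw [pow_succ, length_mul, ih, Nat.succ_mul]

theorem isUnit_eval_of_length_eq_zero {z : RigidFactorization H} (h : length z = 0) :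
    IsUnit (eval z) := by
  obtain ⟨ε, l⟩ := z
  obtain rfl : l = [] := List.length_eq_zero_iff.1 h
  exact ⟨ε, (eval_ofUnit ε).symm⟩

theorem irreducible_eval_of_length_eq_one {z : RigidFactorization H} (h : length z = 1) :
    Irreducible (eval z) := by
  obtain ⟨ε, l⟩ := z
  obtain ⟨u, rfl⟩ := List.length_eq_one_iff.1 h
  change Irreducible ((ε : H) * (List.map Subtype.val [u]).prod)
  simpa using (irreducible_units_mul ε).2 u.2

theorem exists_mul_eq_of_le_length (z : RigidFactorization H) {s : ℕ} (hs : s ≤ length z) :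
    ∃ x y : RigidFactorization H, z = x * y ∧ length x = s ∧ length y = length z - s := by
  obtain ⟨ε, l⟩ := z
  change s ≤ l.length at hs
  refine ⟨Quotient.mk (rigidSetoid H) (ε, l.take s), Quotient.mk (rigidSetoid H) (1, l.drop s),
    ?_, List.length_take_of_le hs, List.length_drop⟩
  refine congrArg (Quotient.mk (rigidSetoid H)) ?_
  have h1 : (fun u : Atom H => u.mulUnit 1) = id := by
    funext u
    exact Subtype.ext (by simp [Atom.mulUnit])
  unfold PreFactorization.mul
  split_ifs with h
  · have h0 : s = 0 := (List.length_take_of_le hs).symm.trans h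
    simp [h0]
  · simp [h1, List.modify_id]

theorem exists_eval_eq_list_prod (l : List (Atom H)) :
    ∃ z : RigidFactorization H, eval z = (l.map Subtype.val).prod := by
  induction l with
  | nil => exact ⟨1, by simp⟩
  | cons u l ih =>
    obtain ⟨z, hz⟩ := ih
    exact ⟨ofAtom u * z, by simp [hz]⟩

/-- Two factorizations that differ only in middle parts of length at most `B`. -/
def Step (B : ℕ) (z z' : RigidFactorization H) : Prop :=
  ∃ x y y' w : RigidFactorization H, z = x * y * w ∧ z' = x * y' * w ∧ eval y = eval y' ∧
    length y ≤ B ∧ length y' ≤ B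

namespace Step

variable {B : ℕ} {z z' : RigidFactorization H}

theorem symm (h : Step B z z') : Step B z' z := by
  obtain ⟨x, y, y', w, h1, h2, h3, h4, h5⟩ := h
  exact ⟨x, y', y, w, h2, h1, h3.symm, h5, h4⟩

theorem mul_left (h : Step B z z') (t : RigidFactorization H) : Step B (t * z) (t * z') := by
  obtain ⟨x, y, y', w, rfl, rfl, h⟩ := h
  exact ⟨t * x, y, y', w, by simp [mul_assoc], by simp [mul_assoc], h⟩

theorem eval_eq (h : Step B z z') : eval z = eval z' := by
  obtain ⟨x, y, y', w, rfl, rfl, h, -⟩ := h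
  simp [h]

theorem length_le (h : Step B z z') : length z' ≤ length z + B := by
  obtain ⟨x, y, y', w, rfl, rfl, -, -, h⟩ := h
  simp only [length_mul]
  omega

theorem distance_le (h : Step B z z') (hB : 1 ≤ B) (δ : FactorizationDistance H) :
    δ.d z z' ≤ B := by
  obtain ⟨x, y, y', w, rfl, rfl, h1, h2, h3⟩ := h
  rw [δ.mul_right _ _ _ (by simp [h1]), δ.mul_left _ _ _ h1]
  exact (δ.le_length _ _ h1).trans (max_le (max_le h2 h3) hB)

end Step

open Relation

theorem eval_eq_of_reflTransGen_step {B : ℕ} {z z' : RigidFactorization H}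
    (h : ReflTransGen (Step B) z z') : eval z = eval z' := by
  induction h with
  | refl => rfl
  | tail _ h ih => exact ih.trans h.eval_eq

theorem hasChain_of_reflTransGen_step {B : ℕ} (hB : 1 ≤ B) (δ : FactorizationDistance H)
    {z z' : RigidFactorization H} (h : ReflTransGen (Step B) z z') :
    δ.HasChain (eval z') B z z' := by
  induction h using ReflTransGen.head_induction_on with
  | refl => exact ⟨0, fun _ => z', rfl, rfl, by simp, by simp⟩
  | @head x y hxy _ ih =>
    obtain ⟨n, c, h0, hn, hev, hd⟩ := ih
    refine ⟨n + 1, fun i => Nat.casesOn i x c, rfl, hn, fun i hi => ?_, fun i hi => ?_⟩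
    · cases i with
      | zero => exact hxy.eval_eq.trans (h0 ▸ hev 0 (Nat.zero_le _))
      | succ i => exact hev i (Nat.le_of_succ_le_succ hi)
    · cases i with
      | zero =>
        change ((δ.d x (c 0) : ℕ) : ℕ∞) ≤ B
        rw [h0]
        exact_mod_cast hxy.distance_le hB δ
      | succ i => exact hd i (Nat.lt_of_succ_lt_succ hi)

end RigidFactorization

open RigidFactorization Relation

/-- If all factorizations of the same element are linked by steps of size at most `B`, then the
catenary degree is at most `B` in every distance. -/
theorem catenaryDegree_le_of_steps {B : ℕ} (hB : 1 ≤ B)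
    (h : ∀ z z' : RigidFactorization H, eval z = eval z' → ReflTransGen (Step B) z z')
    (δ : FactorizationDistance H) : δ.catenaryDegree ≤ B :=
  iSup_le fun _ => sInf_le fun z z' hz hz' =>
    hz' ▸ hasChain_of_reflTransGen_step hB δ (h z z' (hz.trans hz'.symm))

/-- A step raises the length by at most `B`, so a chain starting at the lower end of a longer gap
can never cross it. -/
theorem setOfDistances_subset_of_steps {B : ℕ}
    (h : ∀ z z' : RigidFactorization H, eval z = eval z' → ReflTransGen (Step B) z z') :
    setOfDistances H ⊆ Set.Iic B := by
  intro d hd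
  obtain ⟨a, -, _, ⟨z, hz, rfl⟩, _, ⟨z', hz', rfl⟩, hl, hgap⟩ := Set.mem_iUnion.1 hd
  by_contra hlt
  rw [Set.mem_Iic, not_le] at hlt
  have key : ∀ y, ReflTransGen (Step B) z y → length y ≤ length z := by
    intro y hy
    induction hy with
    | refl => exact le_rfl
    | @tail x y hx hxy ih =>
      by_contra hy
      have hle := hxy.length_le
      have hmem : length y ∈ lengths a ∩ Set.Icc (length z) (length z') :=
        ⟨⟨y, by rw [← hxy.eval_eq, ← eval_eq_of_reflTransGen_step hx, hz], rfl⟩,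
          by omega, by omega⟩
      rw [hgap, Set.mem_insert_iff, Set.mem_singleton_iff] at hmem
      omega
  have := key z' (h z z' (hz.trans hz'.symm))
  omega

/-- A function `V : H → ℕ` that behaves like a valuation on a monoid whose divisibility is decided
by `V` up to an error of `N`. -/
structure IsValuedWithin (V : H → ℕ) (N : ℕ) : Prop where
  pos : 0 < N
  map_mul : ∀ a b, V (a * b) = V a + V b
  eq_zero_iff : ∀ a, V a = 0 ↔ IsUnit a
  exists_eq : ∃ a, V a = N
  exists_mul : ∀ a b, V a + N ≤ V b → ∃ c, b = a * c

/-! ### Arithmetic of monoids valued within `N` -/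

namespace IsValuedWithin

variable {V : H → ℕ} {N : ℕ}

/-- From an element of value at least `2N` one can split off a left factor of value `N`, leaving a
cofactor of value at least `N`; neither is a unit. -/
theorem le_of_irreducible (h : IsValuedWithin V N) {u : H} (hu : Irreducible u) :
    V u ≤ 2 * N - 1 := by
  by_contra hlt
  obtain ⟨x, hx⟩ := h.exists_eq
  obtain ⟨c, rfl⟩ := h.exists_mul x u (by omega)
  have hN := h.pos
  rw [h.map_mul] at hlt
  rcases hu.isUnit_or_isUnit rfl with hx' | hc
  · have := (h.eq_zero_iff x).2 hx'
    omega
  · have := (h.eq_zero_iff c).2 hc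
    omega

theorem pos_of_irreducible (h : IsValuedWithin V N) {u : H} (hu : Irreducible u) : 0 < V u :=
  Nat.pos_of_ne_zero fun h0 => hu.not_isUnit ((h.eq_zero_iff u).1 h0)

theorem isAtomicMonoid (h : IsValuedWithin V N) : IsAtomicMonoid H := by
  intro a
  induction hn : V a using Nat.strong_induction_on generalizing a with
  | _ n ih =>
    intro ha
    by_cases hirr : Irreducible a
    · exact ⟨[⟨a, hirr⟩], by simp⟩
    · rw [irreducible_iff, not_and] at hirr
      have := hirr ha
      push Not at this
      obtain ⟨b, c, rfl, hb, hc⟩ := this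
      have hb0 := mt (h.eq_zero_iff b).1 hb
      have hc0 := mt (h.eq_zero_iff c).1 hc
      rw [h.map_mul] at hn
      obtain ⟨l, hl⟩ := ih (V b) (by omega) b rfl hb
      obtain ⟨l', hl'⟩ := ih (V c) (by omega) c rfl hc
      exact ⟨l ++ l', by rw [List.map_append, List.prod_append, hl, hl']⟩

theorem exists_eval_eq (h : IsValuedWithin V N) (a : H) :
    ∃ z : RigidFactorization H, eval z = a := by
  by_cases ha : IsUnit a
  · exact ⟨ofUnit ha.unit, by simp⟩
  · obtain ⟨l, rfl⟩ := h.isAtomicMonoid a ha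
    exact exists_eval_eq_list_prod l

theorem length_le_and_le (h : IsValuedWithin V N) (z : RigidFactorization H) :
    length z ≤ V (eval z) ∧ V (eval z) ≤ (2 * N - 1) * length z := by
  induction hn : length z generalizing z with
  | zero => simp [(h.eq_zero_iff _).2 (isUnit_eval_of_length_eq_zero hn)]
  | succ n ih =>
    obtain ⟨x, y, rfl, hx, hy⟩ := exists_mul_eq_of_le_length z (s := n) (by omega)
    have hy' := irreducible_eval_of_length_eq_one (z := y) (by omega)
    obtain ⟨h1, h2⟩ := ih x hx
    have h3 := h.pos_of_irreducible hy'
    have h4 := h.le_of_irreducible hy'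
    rw [_root_.map_mul, h.map_mul, Nat.mul_succ]
    omega

theorem exists_irreducible_le (h : IsValuedWithin V N) : ∃ u : Atom H, V u ≤ N := by
  obtain ⟨a, ha⟩ := h.exists_eq
  obtain ⟨z, rfl⟩ := h.exists_eval_eq a
  have hz : 1 ≤ length z := by
    by_contra hlt
    have := (h.eq_zero_iff _).2 (isUnit_eval_of_length_eq_zero (z := z) (by omega))
    have := h.pos
    omega
  obtain ⟨x, y, rfl, hx, -⟩ := exists_mul_eq_of_le_length z hz
  rw [_root_.map_mul, h.map_mul] at ha
  exact ⟨⟨eval x, irreducible_eval_of_length_eq_one hx⟩, by simp only; omega⟩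

theorem kElasticity_le (h : IsValuedWithin V N) (k : ℕ) :
    ∀ l ∈ unionLengths H k, l ≤ (2 * N - 1) * k := by
  rintro l ⟨a, ⟨z, rfl, rfl⟩, ⟨z', hz', rfl⟩⟩
  have := (h.length_le_and_le z').1
  rw [hz'] at this
  exact this.trans (h.length_le_and_le z).2

theorem elasticity_le (h : IsValuedWithin V N) : elasticity H ≤ ((2 * N - 1 : ℕ) : ℝ≥0∞) := by
  have hN := h.pos
  refine iSup_le fun a => ?_
  unfold elasticityAt
  split_ifs
  · exact_mod_cast (by omega : 1 ≤ 2 * N - 1)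
  · refine ENNReal.div_le_of_le_mul (iSup₂_le fun l hl => ?_)
    have hmin : sInf (lengths a) ∈ lengths a := Nat.sInf_mem ⟨l, hl⟩
    exact_mod_cast h.kElasticity_le _ l ⟨a, hmin, hl⟩

/-- Take the shortest prefix of value at least `m`. Without its last atom its value, hence its
length, is below `m`, and the last atom adds at most `2N - 1`. -/
theorem exists_prefix (h : IsValuedWithin V N) {m : ℕ} (hm : 0 < m) (z : RigidFactorization H)
    (hz : m ≤ V (eval z)) : ∃ x y : RigidFactorization H, z = x * y ∧ m ≤ V (eval x) ∧
      V (eval x) + 2 ≤ m + 2 * N ∧ length x ≤ m := by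
  classical
  have hex : ∃ s, ∃ x y : RigidFactorization H, z = x * y ∧ length x = s ∧ m ≤ V (eval x) :=
    ⟨_, z, 1, by simp, rfl, hz⟩
  obtain ⟨x, y, rfl, hxs, hxm⟩ := Nat.find_spec hex
  have hmin := fun s => Nat.find_min hex (m := s)
  rw [← hxs] at hmin
  have hpos : 0 < length x := by
    by_contra h0
    have := (h.eq_zero_iff _).2 (isUnit_eval_of_length_eq_zero (z := x) (by omega))
    omega
  obtain ⟨x₁, x₂, rfl, hx₁, hx₂⟩ := exists_mul_eq_of_le_length x (s := length x - 1) (by omega)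
  have h1 : V (eval x₁) < m := by
    by_contra hle
    exact hmin (length x₁) (by omega) ⟨x₁, x₂ * y, by rw [mul_assoc], rfl, by omega⟩
  have h2 := (h.length_le_and_le x₁).1
  have h3 := h.le_of_irreducible (irreducible_eval_of_length_eq_one (z := x₂) (by omega))
  have hN := h.pos
  refine ⟨_, y, rfl, hxm, ?_, ?_⟩
  · rw [_root_.map_mul, h.map_mul]
    omega
  · omega

/-- A prefix of value at least `N + V u` is left divisible by `u`. The prefix has at most `N + V u ≤
2N` atoms, and its cofactor has value at most `3N - 2`, so the replacement has at most `3N - 1`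
atoms. -/
theorem exists_step_ofAtom_mul (h : IsValuedWithin V N) (u : Atom H) (hu : V u ≤ N)
    (z : RigidFactorization H) (hz : N + V u ≤ V (eval z)) :
    ∃ y, Step (3 * N - 1) z (ofAtom u * y) := by
  have hN := h.pos
  obtain ⟨x, w, rfl, h1, h2, h3⟩ := h.exists_prefix (by omega) z hz
  obtain ⟨c, hc⟩ := h.exists_mul u (eval x) (by omega)
  obtain ⟨y, rfl⟩ := h.exists_eval_eq c
  have h4 := (h.length_le_and_le y).1
  rw [hc, h.map_mul] at h2
  refine ⟨y * w, 1, x, ofAtom u * y, w, by simp, by simp [mul_assoc], by simp [hc],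
    by omega, ?_⟩
  rw [length_mul, length_ofAtom]
  omega

theorem reflTransGen_step [IsLeftCancelMul H] (h : IsValuedWithin V N)
    (z z' : RigidFactorization H) (hzz' : eval z = eval z') :
    ReflTransGen (Step (3 * N - 1)) z z' := by
  have hN := h.pos
  obtain ⟨u, hu⟩ := h.exists_irreducible_le
  have hu0 := h.pos_of_irreducible u.2
  induction hn : V (eval z) using Nat.strong_induction_on generalizing z z' with
  | _ n ih =>
    -- Small values need no common atom: both factorizations have at most `2N - 1` atoms, so one is
    -- exchanged for the other in a single step.
    by_cases hlt : n < N + V u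
    · have h1 := (h.length_le_and_le z).1
      have h2 := (h.length_le_and_le z').1
      rw [← hzz'] at h2
      exact .single ⟨1, z, z', 1, by simp, by simp, hzz', by omega, by omega⟩
    · obtain ⟨y, hy⟩ := h.exists_step_ofAtom_mul u hu z (by omega)
      obtain ⟨y', hy'⟩ := h.exists_step_ofAtom_mul u hu z' (by rw [← hzz']; omega)
      have he : eval y = eval y' := by
        have := hy.eval_eq.symm.trans (hzz'.trans hy'.eval_eq)
        simpa using this
      have hV : V (eval z) = V u + V (eval y) := by
        rw [hy.eval_eq, _root_.map_mul, h.map_mul, eval_ofAtom]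
      have hrec := ih (V (eval y)) (by omega) y y' he rfl
      exact .head hy (.tail (hrec.lift (ofAtom u * ·) fun _ _ hs => hs.mul_left _) hy'.symm)

theorem mem_unionLengths_self (h : IsValuedWithin V N) (k : ℕ) : k ∈ unionLengths H k := by
  obtain ⟨u, -⟩ := h.exists_irreducible_le
  have : k ∈ lengths (eval (ofAtom u ^ k)) := ⟨_, rfl, by simp⟩
  exact ⟨_, this, this⟩

/-- Delete the last atom from the factorization of length `k + 1` and `4N` atoms from the other. The
first loses value at most `2N - 1`, the second at least `4N`, so the second remaining product left
divides the first and can be completed to a factorization of it. -/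
theorem exists_mem_unionLengths_le (h : IsValuedWithin V N) (k : ℕ) :
    ∀ l ∈ unionLengths H (k + 1), ∃ l' ∈ unionLengths H k, l ≤ l' + 4 * N := by
  rintro l ⟨a, ⟨z, hz, hzk⟩, ⟨y, rfl, rfl⟩⟩
  by_cases hl : length y ≤ 4 * N
  · exact ⟨k, h.mem_unionLengths_self k, by omega⟩
  · obtain ⟨z₁, z₂, rfl, hz₁, hz₂⟩ := exists_mul_eq_of_le_length z (s := k) (by omega)
    obtain ⟨y₁, y₂, rfl, hy₁, hy₂⟩ :=
      exists_mul_eq_of_le_length y (s := length y - 4 * N) (by omega)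
    have h1 := h.le_of_irreducible (irreducible_eval_of_length_eq_one (z := z₂) (by omega))
    have h2 := (h.length_le_and_le y₂).1
    have h3 := congrArg V hz
    simp only [_root_.map_mul, h.map_mul] at h3
    obtain ⟨c, hc⟩ := h.exists_mul (eval y₁) (eval z₁) (by omega)
    obtain ⟨w, rfl⟩ := h.exists_eval_eq c
    refine ⟨length (y₁ * w), ⟨eval z₁, ⟨z₁, rfl, hz₁⟩,
      ⟨y₁ * w, by rw [_root_.map_mul, hc], rfl⟩⟩, ?_⟩
    have h4 := length_mul y₁ w
    have h5 := length_mul y₁ y₂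
    omega

theorem kElasticity_add_one_le (h : IsValuedWithin V N) (k : ℕ) :
    kElasticity H (k + 1) ≤ kElasticity H k + (4 * N : ℕ) := by
  refine iSup₂_le fun l hl => ?_
  obtain ⟨l', hl', hle⟩ := h.exists_mem_unionLengths_le k l hl
  calc (l : ℕ∞) ≤ (l' : ℕ∞) + (4 * N : ℕ) := by exact_mod_cast hle
    _ ≤ _ := by
      gcongr
      exact le_iSup₂_of_le (f := fun (l : ℕ) (_ : l ∈ unionLengths H k) => (l : ℕ∞)) l' hl' le_rfl

theorem structureTheoremForUnions (h : IsValuedWithin V N) : StructureTheoremForUnions H :=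
  exists_isAAP_of_unions _ _ _ h.mem_unionLengths_self (fun _ _ ⟨a, h1, h2⟩ => ⟨a, h2, h1⟩)
    (by
      rintro k l k' l' ⟨a, ⟨x, hx, rfl⟩, ⟨y, hy, rfl⟩⟩ ⟨b, ⟨x', hx', rfl⟩, ⟨y', hy', rfl⟩⟩
      exact ⟨a * b, ⟨x * x', by simp [hx, hx'], by simp⟩, ⟨y * y', by simp [hy, hy'], by simp⟩⟩)
    h.kElasticity_le h.exists_mem_unionLengths_le

end IsValuedWithin

end Factorizations

end RigidFact

namespace RigidFact

/-! ### From orders to valued monoids -/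

section Valuations

theorem exists_le_addValuation_of_fg {S A : Type*} [CommRing S] [Ring A] [Algebra S A]
    (v : AddValuation A (WithTop ℤ)) (hv : ∀ s : S, 0 ≤ v (algebraMap S A s))
    {M : Submodule S A} (hM : M.FG) : ∃ c : ℤ, ∀ x ∈ M, (c : WithTop ℤ) ≤ v x := by
  obtain ⟨t, rfl⟩ := hM
  obtain ⟨c, hc⟩ : ∃ c : ℤ, ∀ s ∈ t, (c : WithTop ℤ) ≤ v s := by
    classical
    induction t using Finset.induction_on with
    | empty => exact ⟨0, by simp⟩
    | insert a t _ ih =>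
      obtain ⟨c, hc⟩ := ih
      obtain ⟨c', hc'⟩ : ∃ c' : ℤ, (c' : WithTop ℤ) ≤ v a := by
        cases v a with
        | top => exact ⟨0, le_top⟩
        | coe k => exact ⟨k, le_rfl⟩
      refine ⟨min c c', fun s hs => ?_⟩
      rcases Finset.mem_insert.1 hs with rfl | hs
      · exact le_trans (by exact_mod_cast min_le_right c c') hc'
      · exact le_trans (by exact_mod_cast min_le_left c c') (hc s hs)
  refine ⟨c, fun x hx => ?_⟩
  induction hx using Submodule.span_induction with
  | mem x hx => exact hc x hx
  | zero => simp
  | add x y _ _ hx hy => exact v.map_le_add hx hy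
  | smul a x _ hx =>
    rw [Algebra.smul_def, v.map_mul]
    calc (c : WithTop ℤ) ≤ v x := hx
      _ = 0 + v x := (zero_add _).symm
      _ ≤ _ := by gcongr; exact hv a

/-- A valuation non-negative on scalars is bounded below on a finitely generated module, but the
powers of an element of negative value are not. -/
theorem addValuation_nonneg_of_fg {S A : Type*} [CommRing S] [Ring A] [Algebra S A]
    (v : AddValuation A (WithTop ℤ)) (hv : ∀ s : S, 0 ≤ v (algebraMap S A s))
    (R : Subalgebra S A) (hR : (Subalgebra.toSubmodule R).FG) (x : A) (hx : x ∈ R) : 0 ≤ v x := by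
  obtain ⟨c, hc⟩ := exists_le_addValuation_of_fg v hv hR
  have h := hc _ (R.pow_mem hx (c.natAbs + 1))
  rw [v.map_pow] at h
  cases hk : v x with
  | top => exact le_top
  | coe k =>
    rw [hk, ← WithTop.coe_nsmul, WithTop.coe_le_coe, nsmul_eq_mul] at h
    by_contra hlt
    have hk0 : k ≤ -1 := by
      have : k < 0 := by exact_mod_cast not_le.1 hlt
      omega
    have h1 : ((c.natAbs + 1 : ℕ) : ℤ) * k ≤ ((c.natAbs + 1 : ℕ) : ℤ) * (-1) := by gcongr
    omega

end Valuations

variable {D K A : Type*} [CommRing D] [IsDomain D] [IsDiscreteValuationRing D]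
  [Field K] [Algebra D K] [IsFractionRing D K]
  [DivisionRing A] [Algebra K A] [Algebra D A] [IsScalarTower D K A] [FiniteDimensional K A]

namespace IsConductorExponent

variable {R : Subalgebra D A} {v : AddValuation A (WithTop ℤ)} {n : ℕ}

include K in
theorem exists_le_algebraMap (hv : IsConductorExponent D R v n) :
    ∃ c : D, c ≠ 0 ∧ ((n : ℤ) : WithTop ℤ) ≤ v (algebraMap D A c) := by
  -- If `v` vanished on all non-zero elements of `D`, it would be non-negative on `K`, hence on the
  -- finite `K`-algebra `A`, against surjectivity.
  obtain ⟨p, hp0, hp⟩ : ∃ p : D, p ≠ 0 ∧ v (algebraMap D A p) ≠ 0 := by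
    by_contra! hcon
    have hK (a : K) : 0 ≤ v (algebraMap K A a) := by
      obtain ⟨x, y, hy, rfl⟩ := IsFractionRing.div_surjective D a
      rw [map_div₀, ← IsScalarTower.algebraMap_apply, ← IsScalarTower.algebraMap_apply,
        div_eq_mul_inv, v.map_mul, v.map_inv, hcon y (nonZeroDivisors.ne_zero hy)]
      simpa using hv.nonneg x
    obtain ⟨x, hx⟩ := hv.surjective ((-1 : ℤ) : WithTop ℤ)
    have := addValuation_nonneg_of_fg v hK ⊤
      (by rw [Algebra.top_toSubmodule]; exact Module.Finite.fg_top) x trivial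
    rw [hx] at this
    norm_cast at this
  refine ⟨p ^ n, pow_ne_zero _ hp0, ?_⟩
  have h0 := hv.nonneg p
  rw [map_pow, v.map_pow]
  cases hk : v (algebraMap D A p) with
  | top =>
    rw [AddValuation.top_iff, IsScalarTower.algebraMap_apply D K A] at hk
    simp [hp0] at hk
  | coe k =>
    rw [hk] at h0 hp
    have hk1 : 1 ≤ k := by
      have h1 : 0 ≤ k := by exact_mod_cast h0
      have h2 : k ≠ 0 := by exact_mod_cast hp
      omega
    rw [← WithTop.coe_nsmul, WithTop.coe_le_coe, nsmul_eq_mul]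
    nlinarith

omit [IsDomain D] [IsDiscreteValuationRing D] [Algebra D K] [IsFractionRing D K]
  [IsScalarTower D K A] [FiniteDimensional K A] in
theorem nonneg_of_mem (hv : IsConductorExponent D R v n) (hR : IsOrder D K R) {x : A}
    (hx : x ∈ R) : 0 ≤ v x :=
  addValuation_nonneg_of_fg v hv.nonneg R (Module.Finite.iff_fg.1 hR.finite) x hx

/-- The valuation ring `O` embeds into `R` by multiplication with a scalar of large value, so it is
a noetherian `D`-module. The chain of submodules `{y ∈ O | x ^ k * y ∈ R}` stabilizes, and testing
it on `x⁻¹ ^ (k + 1)` gives the claim. -/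
theorem inv_mem (hv : IsConductorExponent D R v n) (hR : IsOrder D K R) {x : A} (hx : x ∈ R)
    (hvx : v x = 0) : x⁻¹ ∈ R := by
  obtain ⟨c, hc0, hc⟩ := hv.exists_le_algebraMap (K := K)
  have hcA : algebraMap D A c ≠ 0 := by
    rw [IsScalarTower.algebraMap_apply D K A]
    simpa using hc0
  let O : Subalgebra D A :=
    { carrier := {y | 0 ≤ v y}
      mul_mem' := fun {a b} ha hb => by
        change 0 ≤ v (a * b)
        rw [v.map_mul]
        exact add_nonneg ha hb
      add_mem' := fun {a b} ha hb => v.map_le_add ha hb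
      algebraMap_mem' := hv.nonneg }
  have hcO (y : A) (hy : y ∈ O) : c • y ∈ R := by
    refine hv.isLeast.1 _ ?_
    rw [Algebra.smul_def, v.map_mul]
    calc ((n : ℤ) : WithTop ℤ) = ((n : ℤ) : WithTop ℤ) + 0 := (add_zero _).symm
      _ ≤ _ := add_le_add hc hy
  let f : O →ₗ[D] R :=
    { toFun := fun y => ⟨c • (y : A), hcO y y.2⟩
      map_add' := fun a b => Subtype.ext (smul_add _ _ _)
      map_smul' := fun a b => Subtype.ext (smul_comm _ _ _) }
  have hf : Function.Injective f := by
    intro a b hab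
    have h : c • (a : A) = c • (b : A) := congrArg Subtype.val hab
    rw [Algebra.smul_def, Algebra.smul_def] at h
    exact Subtype.ext (mul_left_cancel₀ hcA h)
  have := hR.finite
  have : Module.Finite D O := Module.Finite.of_injective f hf
  have hinv : x⁻¹ ∈ O := by
    change 0 ≤ v x⁻¹
    rw [v.map_inv, hvx, neg_zero]
  rcases eq_or_ne x 0 with rfl | hx0
  · rwa [inv_zero]
  let M : ℕ →o Submodule D O :=
    { toFun := fun k => (Subalgebra.toSubmodule R).comap
        ((LinearMap.mulLeft D (x ^ k)).comp O.val.toLinearMap)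
      monotone' := monotone_nat_of_le_succ fun k y hy => by
        change x ^ (k + 1) * (y : A) ∈ R
        rw [pow_succ', mul_assoc]
        exact R.mul_mem hx hy }
  obtain ⟨k, hk⟩ := monotone_stabilizes_iff_noetherian.2 (inferInstance : IsNoetherian D O) M
  have hmem : (⟨x⁻¹, hinv⟩ : O) ^ (k + 1) ∈ M (k + 1) := by
    change x ^ (k + 1) * x⁻¹ ^ (k + 1) ∈ R
    rw [inv_pow, mul_inv_cancel₀ (pow_ne_zero _ hx0)]
    exact R.one_mem
  rw [← hk (k + 1) (Nat.le_succ k)] at hmem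
  change x ^ k * x⁻¹ ^ (k + 1) ∈ R at hmem
  rwa [pow_succ, ← mul_assoc, inv_pow, mul_inv_cancel₀ (pow_ne_zero _ hx0), one_mul] at hmem

theorem isValuedWithin (hv : IsConductorExponent D R v n) (hR : IsOrder D K R) :
    IsValuedWithin (fun x : cancellative R => ((v (x : R)).untopD 0).toNat) (max n 1) := by
  have hne (x : cancellative R) : ((x : R) : A) ≠ 0 := by
    have := x.2.ne_zero
    simpa using this
  -- Cancellative elements are non-zero with value at least zero, so neither the default of `untopD`
  -- nor the truncation of `toNat` occurs.
  have hV (x : cancellative R) :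
      v (x : R) = ((((v (x : R)).untopD 0).toNat : ℤ) : WithTop ℤ) := by
    have h0 := hv.nonneg_of_mem hR (x : R).2
    cases hk : v (x : R) with
    | top => exact absurd (v.top_iff.1 hk) (hne x)
    | coe k =>
      rw [hk] at h0
      have h1 : 0 ≤ k := by exact_mod_cast h0
      simp [h1]
  have hmem (x : A) (hx : x ∈ R) (hx0 : x ≠ 0) : (⟨x, hx⟩ : R) ∈ cancellative R :=
    IsRegular.of_ne_zero fun h => hx0 (congrArg Subtype.val h)
  have hmul (a b : cancellative R) : ((v ((a * b : cancellative R) : R)).untopD 0).toNat =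
      ((v (a : R)).untopD 0).toNat + ((v (b : R)).untopD 0).toNat := by
    have h := hV (a * b)
    have h' : v ((a * b : cancellative R) : R) = v (a : R) + v (b : R) := v.map_mul _ _
    rw [h', hV a, hV b] at h
    rw [h']
    rw [hV a, hV b]
    norm_cast at h ⊢
  have hle (m : ℕ) (x : A) (hx : v x = ((m : ℤ) : WithTop ℤ)) (hm : n ≤ m) :
      ∃ y : cancellative R, ((y : R) : A) = x := by
    have hxR : x ∈ R := hv.isLeast.1 x (by rw [hx]; exact_mod_cast hm)
    have hx0 : x ≠ 0 := by
      rintro rfl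
      simp at hx
    exact ⟨⟨⟨x, hxR⟩, hmem x hxR hx0⟩, rfl⟩
  refine ⟨by omega, hmul, fun a => ⟨fun h => ?_, ?_⟩, ?_, fun a b hab => ?_⟩
  · have hva := hV a
    rw [h] at hva
    have hinv := hv.inv_mem hR (a : R).2 (by simpa using hva)
    let b : cancellative R := ⟨⟨_, hinv⟩, hmem _ hinv (inv_ne_zero (hne a))⟩
    refine ⟨⟨a, b, ?_, ?_⟩, rfl⟩
    · exact Subtype.ext (Subtype.ext (mul_inv_cancel₀ (hne a)))
    · exact Subtype.ext (Subtype.ext (inv_mul_cancel₀ (hne a)))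
  · rintro ⟨u, rfl⟩
    have h := hmul (u : cancellative R) ((u⁻¹ : (cancellative R)ˣ) : cancellative R)
    rw [Units.mul_inv] at h
    have h1 : v (((1 : cancellative R) : R) : A) = 0 := v.map_one
    rw [h1] at h
    exact (Nat.add_eq_zero_iff.1 h.symm).1
  · obtain ⟨x, hx⟩ := hv.surjective (((max n 1 : ℕ) : ℤ) : WithTop ℤ)
    obtain ⟨y, rfl⟩ := hle _ x hx (le_max_left _ _)
    rw [hV y] at hx
    exact ⟨y, by exact_mod_cast hx⟩
  · have hva := hV a
    have hvb := hV b
    obtain ⟨d, hd⟩ := Nat.exists_eq_add_of_le hab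
    -- The quotient `a⁻¹ * b` has value at least `n`, so it lies in `R`.
    obtain ⟨y, hy⟩ := hle (max n 1 + d) (((a : R) : A)⁻¹ * ((b : R) : A)) (by
      rw [v.map_mul, v.map_inv, hva, hvb, hd]
      norm_cast
      push_cast
      ring) (by omega)
    exact ⟨y, Subtype.ext (Subtype.ext (by
      change ((b : R) : A) = ((a : R) : A) * ((y : R) : A)
      rw [hy, mul_inv_cancel_left₀ (hne a)]))⟩

end IsConductorExponent

instance {M : Type*} [Monoid M] : IsLeftCancelMul (cancellative M) :=
  ⟨fun a _ _ h => Subtype.ext (a.2.left (congrArg Subtype.val h))⟩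

end RigidFact

/-! ### The main theorem -/

open RigidFact in
theorem mainTheorem2 {D K A : Type*} [CommRing D] [IsDomain D] [IsDiscreteValuationRing D]
    [Field K] [Algebra D K] [IsFractionRing D K]
    [DivisionRing A] [Algebra K A] [Algebra D A] [IsScalarTower D K A]
    [FiniteDimensional K A] [Algebra.IsCentral K A]
    (hA : ∀ x : A ⊗[K] Completion D K, x ≠ 0 → IsUnit x)
    (R : Subalgebra D A) (hR : IsOrder D K R) :
    IsAtomicMonoid (cancellative R) ∧
    elasticity (cancellative R) < ⊤ ∧
    (∀ k : ℕ, kElasticity (cancellative R) k < ⊤) ∧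
    (∀ δ : FactorizationDistance (cancellative R), δ.catenaryDegree < ⊤) ∧
    ((∃ (v : AddValuation A (WithTop ℤ)) (n : ℕ), IsConductorExponent D R v n) ∧
      ∀ (v : AddValuation A (WithTop ℤ)) (n : ℕ), IsConductorExponent D R v n →
        ∀ δ : FactorizationDistance (cancellative R),
          δ.catenaryDegree ≤ ((3 * max n 1 - 1 : ℕ) : ℕ∞)) ∧
    (setOfDistances (cancellative R)).Finite ∧
    (∃ M : ℕ, 0 < M ∧ ∀ k : ℕ, 2 ≤ k →
      kElasticity (cancellative R) k ≤ kElasticity (cancellative R) (k - 1) + M) ∧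
    StructureTheoremForUnions (cancellative R) := by
  have hcat (v : AddValuation A (WithTop ℤ)) (n : ℕ) (hv : IsConductorExponent D R v n)
      (δ : FactorizationDistance (cancellative R)) :
      δ.catenaryDegree ≤ ((3 * max n 1 - 1 : ℕ) : ℕ∞) :=
    catenaryDegree_le_of_steps (by omega) (hv.isValuedWithin hR).reflTransGen_step δ
  obtain ⟨v, n, hv⟩ := exists_isConductorExponent hA R hR
  have h := hv.isValuedWithin hR
  refine ⟨h.isAtomicMonoid, h.elasticity_le.trans_lt (ENNReal.natCast_lt_top _), fun k => ?_,
    fun δ => (hcat v n hv δ).trans_lt (ENat.natCast_lt_top _), ⟨⟨v, n, hv⟩, hcat⟩,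
    (Set.finite_Iic _).subset (setOfDistances_subset_of_steps h.reflTransGen_step),
    ⟨4 * max n 1, by omega, fun k hk => ?_⟩, h.structureTheoremForUnions⟩
  · exact (iSup₂_le fun l hl => by exact_mod_cast h.kElasticity_le k l hl).trans_lt
      (ENat.natCast_lt_top ((2 * max n 1 - 1) * k))
  · obtain ⟨j, rfl⟩ := Nat.exists_eq_add_of_le' (show 1 ≤ k by omega)
    exact h.kElasticity_add_one_le j
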